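/- **Definitions.** All languages $\Sigma$ are relational, with predicate symbols of positive arity. A predicate $R\in\Sigma$ is *non-empty* for a complete $\Sigma$-theory $T$ if $\exists\bar x\,R(\bar x)\in T$, and *empty* otherwise. A complete theory $T$ is *language uniform* (LU) if for every arity $n$ every permutation of the set of non-empty $n$-ary predicates (fixing all other symbols) preserves $T$. An LU-theory is an *IILU-theory* if it has a non-empty predicate and, whenever there is a non-empty $n$-ary predicate, there are infinitely many non-empty and infinitely many empty $n$-ary predicates. For non-empty $\Sigma$-structures $\mathcal A_i$, $i\in I$, the *$E$-combination* $\mathcal A_E={\rm Comb}_E(\mathcal A_i)_{i\in I}$ is the structure in the language $\Sigma\cup\{E\}$, with $E$ a new binary symbol, whose universe is the disjoint union of the $\mathcal A_i$, in which $E$ is the equivalence relation with classes $\mathcal A_i$ and each $R\in\Sigma$ is the union of its interpretations in the $\mathcal A_i$. For $\mathcal A'\equiv\mathcal A_E$ each $E$-class of $\mathcal A'$ is regarded as a $\Sigma$-structure by restriction, and ${\rm TH}(\mathcal A')$ is the set of the complete $\Sigma$-theories of the $E$-classes of $\mathcal A'$. A model $\mathcal A'$ of ${\rm Th}(\mathcal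 A_E)$ is *$e$-least* if ${\rm TH}(\mathcal A')\subseteq{\rm TH}(\mathcal A'')$ for every model $\mathcal A''$ of ${\rm Th}(\mathcal A_E)$. The *$e$-spectrum* $e\text{-}{\rm Sp}(\mathcal A')$ is the number of theories that belong to ${\rm TH}(\mathcal A'')$ for some $\mathcal A''\equiv\mathcal A'$ but not to ${\rm TH}(\mathcal A')$, and $e\text{-}{\rm Sp}({\rm Th}(\mathcal A_E))=\sup\{e\text{-}{\rm Sp}(\mathcal A')\mid\mathcal A'\equiv\mathcal A_E\}$. **Proposition 5.3.** For every infinite cardinal $\lambda$ there are a language $\Sigma$ of cardinality $\lambda$ and a family $(\mathcal A_i)_{i\in I}$ of non-empty $\Sigma$-structures, each theory ${\rm Th}(\mathcal A_i)$ being an IILU-theory, such that, for $\mathcal A_E={\rm Comb}_E(\mathcal A_i)_{i\in I}$, the theory $T={\rm Th}(\mathcal A_E)$ has no $e$-least models and $e\text{-}{\rm Sp}(T)\ge\max\{2^{\omega},\lambda\}$. -/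

import Mathlib

open FirstOrder FirstOrder.Language Cardinal

universe u

namespace EComb

/-! ### Language uniform theories -/

section LU

variable {L : FirstOrder.Language.{0, u}}

/-- The replacement of predicate symbols given, in every arity, by a permutation of the symbols of
that arity. -/
def permHom (σ : ∀ m, Equiv.Perm (L.Relations m)) : L →ᴸ L where
  onFunction := fun _ f => f
  onRelation := fun m R => σ m R

/-- The sentence `∃ x₁ … xₙ, R(x₁, …, xₙ)`. -/
def existsSentence {n : ℕ} (R : L.Relations n) : L.Sentence :=
  (R.boundedFormula (fun i : Fin n => (Term.var (Sum.inr i) : L.Term (Empty ⊕ Fin n)))).exs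

/-- The predicate `R` is non-empty for the theory `T`. (Used for complete theories, which are
deductively closed sets of sentences: if `R` is not non-empty for `T`, then it is empty for `T`.) -/
def NonemptyPred (T : L.Theory) {n : ℕ} (R : L.Relations n) : Prop :=
  existsSentence R ∈ T

/-- LU-theories: complete theories `T` such that, for every arity `n`, every permutation of the set
of the `n`-ary predicates that are non-empty for `T` (all other symbols being fixed) preserves
`T`. -/
structure IsLU (T : L.Theory) : Prop where
  complete : T.IsMaximal
  preserved : ∀ (n : ℕ) (σ : ∀ m, Equiv.Perm (L.Relations m)),
    (∀ m, m ≠ n → σ m = 1) → (∀ R : L.Relations n, ¬ NonemptyPred T R → σ n R = R) →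
    (permHom σ).onTheory T = T

/-- IILU-theories: LU-theories that have a non-empty predicate and such that, as soon as some
`n`-ary predicate is non-empty, there are infinitely many non-empty `n`-ary predicates and
infinitely many empty `n`-ary predicates. -/
structure IsIILU (T : L.Theory) : Prop extends IsLU T where
  exists_nonempty : ∃ (n : ℕ) (R : L.Relations n), NonemptyPred T R
  infinite_infinite : ∀ n : ℕ, (∃ R : L.Relations n, NonemptyPred T R) →
    {R : L.Relations n | NonemptyPred T R}.Infinite ∧
    {R : L.Relations n | ¬ NonemptyPred T R}.Infinite

end LU

/-! ### E-combinations -/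

/-- The only symbol of the language of one binary relation. -/
inductive ERel : ℕ → Type u
  | E : ERel 2

/-- The language with the one binary relation symbol `E`. -/
def eLang : FirstOrder.Language.{0, u} := ⟨fun _ => Empty, ERel⟩

/-- The expansion of the language `L` by a new binary relation symbol `E`. -/
abbrev withE (L : FirstOrder.Language.{0, u}) : FirstOrder.Language.{0, u} := L.sum eLang.{u}

/-- The new symbol `E`. -/
def symE (L : FirstOrder.Language.{0, u}) : (withE L).Relations 2 := Sum.inr ERel.E

/-- The universe of the `E`-combination of `A i`, `i ∈ I`: their disjoint union. -/
def Comb {I : Type u} (A : I → Type u) : Type u := Σ i, A i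

section Combination

variable {L : FirstOrder.Language.{0, u}} [L.IsRelational] {I : Type u} (A : I → Type u)
  [∀ i, L.Structure (A i)]

/-- In the `E`-combination a predicate of `L` is the union of its interpretations in
the `A i`. -/
instance combStructure : L.Structure (Comb A) where
  funMap := fun f _ => isEmptyElim f
  RelMap := fun {n} R v => ∃ (i : I) (w : Fin n → A i),
    (∀ k, v k = (⟨i, w k⟩ : Σ i, A i)) ∧ Structure.RelMap R w

/-- In the `E`-combination, `E` is the equivalence relation whose classes are the `A i`. -/
instance combEStructure : eLang.{u}.Structure (Comb A) where
  funMap := fun f _ => Empty.elim f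
  RelMap := fun R => match R with
    | ERel.E => fun v => (v 0).1 = (v 1).1

end Combination

section Classes

variable {L : FirstOrder.Language.{0, u}} {M : Type u} [(withE L).Structure M]

/-- The relation `E` of a structure in the expanded language. -/
def relE (L : FirstOrder.Language.{0, u}) {M : Type u} [(withE L).Structure M] (a b : M) : Prop :=
  Structure.RelMap (symE L) ![a, b]

/-- The universe of the `E`-class of `a`. -/
def EClass (L : FirstOrder.Language.{0, u}) {M : Type u} [(withE L).Structure M] (a : M) : Type u :=
  {b : M // relE L a b}

/-- An `E`-class as a structure in the original language: the restriction of the whole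
structure. -/
instance eClassStructure [L.IsRelational] (a : M) : L.Structure (EClass L a) where
  funMap := fun f _ => isEmptyElim f
  RelMap := fun {n} R v =>
    Structure.RelMap (M := M) (L := withE L) (n := n) (Sum.inl R) (fun k => (v k).1)

end Classes

section Spectrum

variable (L : FirstOrder.Language.{0, u}) [L.IsRelational]

/-- `TH(M)`: the set of the theories of the `E`-classes of `M`. -/
def TH (M : Type u) [(withE L).Structure M] : Set L.Theory :=
  {T | ∃ a : M, T = L.completeTheory (EClass L a)}

/-- `M` is `e`-least: `TH(M)` is the least among the sets `TH(N)` of the models `N`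
of `Th(M)`. -/
def IsELeast (M : Type u) [(withE L).Structure M] : Prop :=
  ∀ (N : Type u) [(withE L).Structure N], N ≅[withE L] M → TH L M ⊆ TH L N

/-- The theories of the structures that are new with respect to the `E`-classes of `M`: those
of `E`-classes of structures elementarily equivalent to `M` that are not elementarily equivalent to
any `E`-class of `M`. -/
def newTheories (M : Type u) [(withE L).Structure M] : Set L.Theory :=
  {T | (∃ (N : Type u) (_ : (withE L).Structure N), (N ≅[withE L] M) ∧ T ∈ TH L N) ∧ T ∉ TH L M}

/-- The `e`-spectrum of the structure `M`: the number of pairwise elementarily non-equivalent new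
structures. -/
noncomputable def eSpStructure (M : Type u) [(withE L).Structure M] : Cardinal.{u} :=
  #(newTheories L M)

/-- The `e`-spectrum of the theory of `M`: the supremum of the `e`-spectra of the structures
elementarily equivalent to `M`. -/
noncomputable def eSp (M : Type u) [(withE L).Structure M] : Cardinal.{u} :=
  sSup {κ | ∃ (N : Type u) (_ : (withE L).Structure N), (N ≅[withE L] M) ∧ κ = eSpStructure L N}

end Spectrum

end EComb

namespace EComb

/-! Let `Q` have the given cardinality κ, with two unary predicates for each `q : Q`. A function `f
: Q → Bool` chooses which predicate of each pair is full, the other being empty; as full predicates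
are interchangeable, this gives an IILU-theory, and the theory recovers `f`. A formula mentions only
finitely many coordinates, so by the Tarski–Vaught test the combination over a set `D` of functions
is elementary in the combination over all of them as soon as `D` is infinitely dense in the Cantor
cube (`comb_elementarilyEquivalent`). The complement of any point is such a set, so every theory of
a class is omitted by some model and none can be e-least. The finitely supported functions form
another, of size at most κ, so one model omits 2^κ theories. -/

instance : eLang.{u}.IsRelational := fun _ => inferInstanceAs (IsEmpty Empty)

theorem nonemptyPred_completeTheory {L : FirstOrder.Language.{0, u}} {M : Type u} [L.Structure M] {n : ℕ} (R : L.Relations n) :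
    NonemptyPred (L.completeTheory M) R ↔ ∃ v : Fin n → M, Structure.RelMap R v := by
  change M ⊨ existsSentence R ↔ _
  unfold existsSentence Sentence.Realize
  rw [BoundedFormula.realize_exs]
  rfl

/-! ### Theories of the classes of a combination -/

section General

variable {L : FirstOrder.Language.{0, u}} [L.IsRelational] {I : Type u} (A : I → Type u)
  [∀ i, L.Structure (A i)]

theorem relE_comb {a b : Comb A} : relE L a b ↔ a.1 = b.1 := Iff.rfl

/-- The `E`-class of an element of an `E`-combination is the summand it comes from. -/
theorem bijective_toEClass (i : I) (x : A i) :
    Function.Bijective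
      (fun w : A i => (⟨⟨i, w⟩, rfl⟩ : EClass L (show Comb A from ⟨i, x⟩))) := by
  refine ⟨fun w w' h => ?_, fun b => ?_⟩
  · have h' : (⟨i, w⟩ : Σ i, A i) = ⟨i, w'⟩ := congrArg Subtype.val h
    simpa using h'
  · obtain ⟨⟨j, w⟩, h⟩ := b
    obtain rfl : i = j := (relE_comb A).1 h
    exact ⟨w, rfl⟩

theorem completeTheory_eClass_comb [IsEmpty (L.Relations 0)] (i : I) (x : A i) :
    L.completeTheory (EClass L (show Comb A from ⟨i, x⟩)) = L.completeTheory (A i) := by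
  let e : A i ≃[L] EClass L (show Comb A from ⟨i, x⟩) :=
    { Equiv.ofBijective _ (bijective_toEClass A i x) with
      map_fun' := fun f => isEmptyElim f
      map_rel' := fun {n} R v => by
        constructor
        -- An argument of `R` determines the summand; a nullary `R` would have none, and its truth
        -- could come from another summand.
        · rintro ⟨j, w, hw, hR⟩
          rcases n with _ | n
          · exact isEmptyElim R
          obtain rfl : i = j := congrArg Sigma.fst (hw 0)
          have : v = w := funext fun k => by
            have h' : (⟨i, v k⟩ : Σ i, A i) = ⟨i, w k⟩ := hw k
            simpa using h'
          rwa [this]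
        · intro h
          exact ⟨i, v, fun _ => rfl, h⟩ }
  exact (StrongHomClass.elementarilyEquivalent e).symm

theorem TH_comb [IsEmpty (L.Relations 0)] [∀ i, Nonempty (A i)] :
    TH L (Comb A) = Set.range fun i => L.completeTheory (A i) := by
  ext T
  constructor
  · rintro ⟨⟨i, x⟩, rfl⟩
    exact ⟨i, (completeTheory_eClass_comb A i x).symm⟩
  · rintro ⟨i, rfl⟩
    exact ⟨⟨i, Classical.arbitrary _⟩, (completeTheory_eClass_comb A i _).symm⟩

theorem mk_newTheories_le_eSp (M : Type u) [(withE L).Structure M] (N : Type u)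
    [(withE L).Structure N] (h : N ≅[withE L] M) : #(newTheories L N) ≤ eSp L M := by
  -- The supremum is meaningful only for a bounded set; the number of all theories is a bound.
  refine le_csSup ⟨#L.Theory, ?_⟩ ⟨N, inferInstance, h, rfl⟩
  rintro _ ⟨N', _, _, rfl⟩
  exact mk_set_le _

/-- A permutation of the predicates that does not change a structure preserves its theory. -/
theorem onTheory_permHom_completeTheory (M : Type u) [L.Structure M]
    (σ : ∀ m, Equiv.Perm (L.Relations m))
    (h : ∀ {m} (R : L.Relations m) (v : Fin m → M),
      Structure.RelMap (σ m R) v ↔ Structure.RelMap R v) :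
    (permHom σ).onTheory (L.completeTheory M) = L.completeTheory M := by
  -- The inverse permutations make every sentence `ψ` the translation of some `φ`.
  let e : L ≃ᴸ L :=
    { toLHom := permHom σ
      invLHom := permHom fun m => (σ m)⁻¹
      left_inv := LHom.funext rfl (by
        funext m R
        exact (σ m).symm_apply_apply R)
      right_inv := LHom.funext rfl (by
        funext m R
        exact (σ m).apply_symm_apply R) }
  have : (permHom σ).IsExpansionOn M :=
    ⟨fun f _ => isEmptyElim f, fun R v => propext (h R v)⟩
  ext ψ
  rw [LHom.mem_onTheory]
  constructor
  · rintro ⟨φ, hφ, rfl⟩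
    exact (LHom.realize_onSentence M (permHom σ) φ).2 hφ
  · intro hψ
    obtain ⟨φ, rfl⟩ := e.onSentence.surjective ψ
    exact ⟨φ, (LHom.realize_onSentence M (permHom σ) φ).1 hψ, rfl⟩

end General

/-! ### Structures given by sets of predicates -/

/-- The unary predicate symbols, two for each `q : Q`. -/
inductive UnaryRel (Q : Type u) : ℕ → Type u
  | mk (q : Q) (b : Bool) : UnaryRel Q 1

/-- The language of the unary predicates `UnaryRel.mk q b`. -/
def unaryLang (Q : Type u) : FirstOrder.Language.{0, u} := ⟨fun _ => Empty, UnaryRel Q⟩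

variable {Q : Type u}

instance : (unaryLang Q).IsRelational := fun _ => inferInstanceAs (IsEmpty Empty)

instance : IsEmpty ((unaryLang Q).Relations 0) := ⟨fun R => by cases R⟩

/-- The predicate symbol with index `(q, b)`. -/
def pred (q : Q) (b : Bool) : (unaryLang Q).Relations 1 := UnaryRel.mk q b

/-- The countable structure in which, for each `q`, the predicate `(q, f q)` holds everywhere and
the predicate `(q, !f q)` holds nowhere. -/
def Uniform (_ : Q → Bool) : Type u := ULift.{u} ℕ

instance (f : Q → Bool) : Nonempty (Uniform f) := inferInstanceAs (Nonempty (ULift ℕ))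

instance (f : Q → Bool) : (unaryLang Q).Structure (Uniform f) where
  funMap := fun φ _ => Empty.elim φ
  RelMap := fun R _ => match R with
    | UnaryRel.mk q b => f q = b

theorem nonemptyPred_uniform (f : Q → Bool) (q : Q) (b : Bool) :
    NonemptyPred ((unaryLang Q).completeTheory (Uniform f)) (pred q b) ↔ f q = b := by
  rw [nonemptyPred_completeTheory]
  exact ⟨fun ⟨_, h⟩ => h, fun h => ⟨fun _ => Classical.arbitrary _, h⟩⟩

theorem relMap_uniform (f : Q → Bool) {n : ℕ} (R : (unaryLang Q).Relations n)
    (v : Fin n → Uniform f) :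
    Structure.RelMap R v ↔ NonemptyPred ((unaryLang Q).completeTheory (Uniform f)) R := by
  cases R with
  | mk q b => exact (nonemptyPred_uniform f q b).symm

theorem completeTheory_uniform_injective :
    Function.Injective fun f : Q → Bool => (unaryLang Q).completeTheory (Uniform f) := by
  intro f g h
  funext q
  have h' := (nonemptyPred_uniform f q (g q))
  simp only at h
  rw [h, nonemptyPred_uniform] at h'
  exact h'.1 rfl

/-- Non-empty predicates are full and empty ones are fixed, so the permutation leaves the structure
itself unchanged. -/
theorem isLU_uniform (f : Q → Bool) : IsLU ((unaryLang Q).completeTheory (Uniform f)) where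
  complete := completeTheory.isMaximal _ _
  preserved := by
    intro n σ h1 hσ
    refine onTheory_permHom_completeTheory _ σ fun {m} R v => ?_
    rw [relMap_uniform, relMap_uniform]
    by_cases hm : m = n
    · subst hm
      by_cases hR : NonemptyPred ((unaryLang Q).completeTheory (Uniform f)) R
      · refine iff_of_true (by_contra fun hR' => hR' ?_) hR
        rwa [(σ m).injective (hσ _ hR')]
      · rw [hσ R hR]
    · rw [h1 m hm]
      rfl

theorem isIILU_uniform [Infinite Q] (f : Q → Bool) :
    IsIILU ((unaryLang Q).completeTheory (Uniform f)) where
  toIsLU := isLU_uniform f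
  exists_nonempty :=
    ⟨1, pred (Classical.arbitrary Q) _, (nonemptyPred_uniform f _ _).2 rfl⟩
  infinite_infinite := by
    have hinj : ∀ g : Q → Bool, Function.Injective fun q => pred q (g q) := fun g q q' h => by
      cases h
      rfl
    rintro n ⟨R, -⟩
    cases R
    refine ⟨(Set.infinite_range_of_injective (hinj f)).mono ?_,
      (Set.infinite_range_of_injective (hinj fun q => !f q)).mono ?_⟩
    · rintro _ ⟨q, rfl⟩
      exact (nonemptyPred_uniform f _ _).2 rfl
    · rintro _ ⟨q, rfl⟩ h
      simpa using (nonemptyPred_uniform f _ _).1 h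

theorem card_unaryLang [Infinite Q] : (unaryLang Q).card = #Q := by
  let e : (unaryLang Q).Symbols ≃ Q × Bool :=
    { toFun := fun s => match s with
        | Sum.inl ⟨_, φ⟩ => Empty.elim φ
        | Sum.inr ⟨_, UnaryRel.mk q b⟩ => (q, b)
      invFun := fun p => Sum.inr ⟨1, UnaryRel.mk p.1 p.2⟩
      left_inv := by
        rintro (⟨_, φ⟩ | ⟨_, ⟨q, b⟩⟩)
        · exact Empty.elim φ
        · rfl
      right_inv := fun _ => rfl }
  rw [Language.card, mk_congr e]
  simp only [mk_prod, lift_uzero, mk_fintype, Fintype.card_bool]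
  simpa using mul_eq_left (aleph0_le_mk Q) ((natCast_lt_aleph0 (n := 2)).le.trans (aleph0_le_mk Q)) two_ne_zero

/-! ### Elementary extensions of combinations -/

theorem relMap_comb_uniform {I : Type u} (F : I → Q → Bool) (q : Q) (b : Bool)
    (v : Fin 1 → Comb fun i => Uniform (F i)) :
    Structure.RelMap (pred q b) v ↔ F (v 0).1 q = b := by
  constructor
  · rintro ⟨i, w, hw, h⟩
    rw [hw 0]
    exact h
  · intro h
    refine ⟨(v 0).1, fun _ => (v 0).2, fun k => ?_, h⟩
    rw [Subsingleton.elim k 0]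
    rfl

/-- The truth of a formula depends on finitely many predicates only: it is invariant under the
bijections that preserve `E` and these predicates. -/
theorem exists_finset_realize_iff {α : Type} {n : ℕ}
    (φ : (withE (unaryLang Q)).BoundedFormula α n) :
    ∃ s : Finset Q, ∀ g : (Comb fun f : Q → Bool => Uniform f) ≃ (Comb fun f : Q → Bool => Uniform f),
      (∀ a b, (g a).1 = (g b).1 ↔ a.1 = b.1) → (∀ q ∈ s, ∀ a, (g a).1 q = a.1 q) →
      ∀ v xs, φ.Realize (g ∘ v) (g ∘ xs) ↔ φ.Realize v xs := by
  classical
  have ht : ∀ {n : ℕ} (t : (withE (unaryLang Q)).Term (α ⊕ Fin n))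
      (g : (Comb fun f : Q → Bool => Uniform f) → (Comb fun f : Q → Bool => Uniform f)) v xs,
      t.realize (Sum.elim (g ∘ v) (g ∘ xs)) = g (t.realize (Sum.elim v xs)) := by
    intro n t g v xs
    cases t with
    | var i => cases i <;> rfl
    | func φ _ => exact isEmptyElim φ
  induction φ with
  | falsum => exact ⟨∅, fun _ _ _ _ _ => Iff.rfl⟩
  | equal t₁ t₂ =>
    refine ⟨∅, fun g _ _ v xs => ?_⟩
    change Term.realize _ _ = Term.realize _ _ ↔ Term.realize _ _ = Term.realize _ _
    rw [ht, ht, g.apply_eq_iff_eq]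
  | rel R ts =>
    rcases R with R | R
    · cases R with
      | mk q b =>
        refine ⟨{q}, fun g _ hs v xs => ?_⟩
        refine (relMap_comb_uniform id q b _).trans (Iff.trans ?_ (relMap_comb_uniform id q b _).symm)
        simp only [ht]
        rw [id, id, hs q (Finset.mem_singleton_self q)]
    · cases R with
      | E =>
        refine ⟨∅, fun g hE _ v xs => ?_⟩
        refine Iff.trans ?_ (hE ((ts 0).realize (Sum.elim v xs)) ((ts 1).realize (Sum.elim v xs)))
        rw [← ht (ts 0) g v xs, ← ht (ts 1) g v xs]
        rfl
  | imp φ ψ ih₁ ih₂ =>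
    obtain ⟨s₁, h₁⟩ := ih₁
    obtain ⟨s₂, h₂⟩ := ih₂
    refine ⟨s₁ ∪ s₂, fun g hE hs v xs => ?_⟩
    rw [BoundedFormula.realize_imp, BoundedFormula.realize_imp,
      h₁ g hE (fun q hq => hs q (Finset.mem_union_left _ hq)),
      h₂ g hE (fun q hq => hs q (Finset.mem_union_right _ hq))]
  | all φ ih =>
    obtain ⟨s, h⟩ := ih
    refine ⟨s, fun g hE hs v xs => ?_⟩
    rw [BoundedFormula.realize_all, BoundedFormula.realize_all, ← g.forall_congr_right]
    refine forall_congr' fun a => ?_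
    rw [← Fin.comp_snoc, h g hE hs]

/-- The sets of functions `Q → Bool` that meet every basic open set in an infinite set. -/
def InfinitelyDense (D : Set (Q → Bool)) : Prop :=
  ∀ (s : Finset Q) (t : Finset (Q → Bool)) (f : Q → Bool), ∃ d ∈ D, d ∉ t ∧ ∀ q ∈ s, d q = f q

/-- The inclusion of the combination of some of the structures `Uniform f` into the combination of
all of them. -/
def combInclusion (D : Set (Q → Bool)) :
    (Comb fun i : D => Uniform i.1) ↪[withE (unaryLang Q)] (Comb fun f : Q → Bool => Uniform f) where
  toFun := fun a => ⟨a.1.1, a.2⟩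
  inj' := by
    rintro ⟨⟨i, hi⟩, x⟩ ⟨⟨j, hj⟩, y⟩ h
    obtain ⟨rfl, h⟩ := Sigma.mk.inj_iff.1 h
    obtain rfl := eq_of_heq h
    rfl
  map_fun' := fun φ => isEmptyElim φ
  map_rel' := by
    rintro n (R | R) x
    · cases R with
      | mk q b =>
        exact (relMap_comb_uniform id q b _).trans
          (relMap_comb_uniform (Subtype.val : D → Q → Bool) q b _).symm
    · cases R with
      | E => exact Subtype.ext_iff.symm

/-- Tarski–Vaught: a witness `a` in a class outside `D` is moved into `D` by swapping its class with
that of some `d ∈ D` that agrees with it on the coordinates of the formula and contains no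
parameter. -/
theorem comb_elementarilyEquivalent {D : Set (Q → Bool)} (hD : InfinitelyDense D) :
    (Comb fun i : D => Uniform i.1) ≅[withE (unaryLang Q)]
      (Comb fun f : Q → Bool => Uniform f) := by
  classical
  refine ElementaryEmbedding.elementarilyEquivalent
    ⟨combInclusion D, fun n' => (combInclusion D).isElementary_of_exists fun n φ x a h => ?_⟩
  by_cases ha : a.1 ∈ D
  · exact ⟨⟨⟨a.1, ha⟩, a.2⟩, h⟩
  obtain ⟨s, hs⟩ := exists_finset_realize_iff φ
  obtain ⟨d, hdD, hdx, hda⟩ := hD s (Finset.univ.image fun k => (x k).1.1) a.1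
  let τ := Equiv.swap a.1 d
  -- All summands have the same universe, so the swap of indices keeps the second component.
  let g : (Comb fun f : Q → Bool => Uniform f) ≃ (Comb fun f : Q → Bool => Uniform f) :=
    { toFun := fun p => ⟨τ p.1, p.2⟩
      invFun := fun p => ⟨τ p.1, p.2⟩
      left_inv := fun p => Sigma.ext (Equiv.swap_apply_self _ _ _) HEq.rfl
      right_inv := fun p => Sigma.ext (Equiv.swap_apply_self _ _ _) HEq.rfl }
  refine ⟨⟨⟨d, hdD⟩, a.2⟩, ?_⟩
  have hg := (hs g (fun p r => τ.apply_eq_iff_eq) (fun q hq p => ?_) default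
    (Fin.snoc (combInclusion D ∘ x) a)).2 h
  · rw [Fin.comp_snoc] at hg
    have hx : g ∘ combInclusion D ∘ x = combInclusion D ∘ x := funext fun k => by
      refine Sigma.ext (Equiv.swap_apply_of_ne_of_ne ?_ ?_) HEq.rfl
      · rintro h'
        exact ha (h' ▸ (x k).1.2)
      · rintro h'
        exact hdx (Finset.mem_image.2 ⟨k, Finset.mem_univ _, h'⟩)
    have ha' : g a = combInclusion D ⟨⟨d, hdD⟩, a.2⟩ :=
      Sigma.ext (Equiv.swap_apply_left _ _) HEq.rfl
    rw [hx, ha'] at hg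
    convert hg
  · change Equiv.swap a.1 d p.1 q = p.1 q
    rw [Equiv.swap_apply_def]
    split_ifs with h1 h2
    · rw [hda q hq, h1]
    · rw [h2, hda q hq]
    · rfl

/-! ### Two infinitely dense sets and the omitted theories -/

/-- The functions that are `true` at finitely many places. -/
def finSupport (Q : Type u) : Set (Q → Bool) :=
  Set.range fun (s : Finset Q) q => open Classical in decide (q ∈ s)

theorem infinitelyDense_finSupport [Infinite Q] : InfinitelyDense (finSupport Q) := by
  classical
  intro s t f
  -- On `s` the approximant copies `f`; one extra point `r` outside `s` yields infinitely many of
  -- them.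
  have hinj : Function.Injective fun (r : (↑s : Set Q)ᶜ.Elem) (q : Q) =>
      decide (q ∈ insert r.1 (s.filter fun q => f q = true)) := by
    intro r r' h
    have h' := congrFun h r.1
    have hr : r.1 ∉ s := r.2
    simp [hr] at h'
    exact Subtype.ext h'
  have : Infinite (↑s : Set Q)ᶜ.Elem := s.finite_toSet.infinite_compl.to_subtype
  obtain ⟨d, ⟨r, rfl⟩, hd⟩ := (Set.infinite_range_of_injective hinj).exists_notMem_finset t
  refine ⟨_, ⟨insert r.1 (s.filter fun q => f q = true), rfl⟩, ?_, fun q hq => ?_⟩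
  · convert hd
  · have hr : q ≠ r.1 := fun h => r.2 (h ▸ hq)
    simp [hr, hq]

/-- Infinite density tolerates finitely many forbidden functions, so `g` is simply added to them. -/
theorem infinitelyDense_compl_singleton [Infinite Q] (g : Q → Bool) :
    InfinitelyDense ({g}ᶜ : Set (Q → Bool)) := by
  classical
  intro s t f
  obtain ⟨d, -, hd, h⟩ := infinitelyDense_finSupport s (insert g t) f
  rw [Finset.mem_insert, not_or] at hd
  exact ⟨d, hd.1, hd.2, h⟩

theorem mk_compl_finSupport [Infinite Q] : #((finSupport Q)ᶜ : Set (Q → Bool)) = 2 ^ #Q := by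
  have hQ : #(Q → Bool) = 2 ^ #Q := by simp
  rw [mk_compl_of_infinite, hQ]
  rw [hQ]
  exact (mk_range_le.trans (mk_finset_of_infinite Q).le).trans_lt (cantor _)

/-- Leastness against the full combination makes the theory of a class of `M` that of some `Uniform
g`; the combination without `g` omits it. -/
theorem not_isELeast_of_elementarilyEquivalent [Infinite Q] (M : Type u)
    [(withE (unaryLang Q)).Structure M]
    (hM : M ≅[withE (unaryLang Q)] (Comb fun f : Q → Bool => Uniform f)) :
    ¬ IsELeast (unaryLang Q) M := by
  intro h
  have : Nonempty (Comb fun f : Q → Bool => Uniform f) :=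
    ⟨⟨fun _ => true, Classical.arbitrary _⟩⟩
  have : Nonempty M := hM.symm.nonempty
  obtain ⟨a⟩ := ‹Nonempty M›
  have ha : (unaryLang Q).completeTheory (EClass (unaryLang Q) a) ∈ TH (unaryLang Q) M :=
    ⟨a, rfl⟩
  have h1 := h _ hM.symm ha
  rw [TH_comb] at h1
  obtain ⟨g, hg⟩ := h1
  have h2 := h _ ((comb_elementarilyEquivalent (infinitelyDense_compl_singleton g)).trans hM.symm) ha
  rw [TH_comb] at h2
  obtain ⟨⟨f, hf⟩, hfg⟩ := h2
  exact hf (completeTheory_uniform_injective (hfg.trans hg.symm))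

/-- The combination over `finSupport Q` omits the theory of `Uniform f` for every other `f`, and the
full combination realizes them all. -/
theorem two_power_le_eSp_comb [Infinite Q] :
    2 ^ #Q ≤ eSp (unaryLang Q) (Comb fun f : Q → Bool => Uniform f) := by
  have hD := comb_elementarilyEquivalent (infinitelyDense_finSupport (Q := Q))
  refine le_trans ?_ (mk_newTheories_le_eSp _ _ hD)
  rw [← mk_compl_finSupport, ← mk_image_eq (s := (finSupport Q)ᶜ) completeTheory_uniform_injective]
  refine mk_le_mk_of_subset ?_
  rintro _ ⟨f, hf, rfl⟩
  refine ⟨⟨_, _, hD.symm, ?_⟩, ?_⟩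
  · rw [TH_comb]
    exact ⟨f, rfl⟩
  · rw [TH_comb]
    rintro ⟨d, hd⟩
    exact hf (completeTheory_uniform_injective hd ▸ d.2)

end EComb

theorem proposition5p3 (κ : Cardinal.{u}) (hκ : ℵ₀ ≤ κ) :
    ∃ (L : FirstOrder.Language.{0, u}) (_ : L.IsRelational) (_ : IsEmpty (L.Relations 0))
      (I : Type u) (A : I → Type u) (_ : ∀ i, L.Structure (A i)) (_ : ∀ i, Nonempty (A i)),
      L.card = κ ∧
      (∀ i, EComb.IsIILU (L.completeTheory (A i))) ∧
      (¬ ∃ (M : Type u) (_ : (EComb.withE L).Structure M),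
        (M ≅[EComb.withE L] EComb.Comb A) ∧ EComb.IsELeast L M) ∧
      max (2 ^ ℵ₀) κ ≤ EComb.eSp L (EComb.Comb A) := by
  have : Infinite κ.out := by rwa [infinite_iff, mk_out]
  refine ⟨EComb.unaryLang κ.out, inferInstance, inferInstance, κ.out → Bool,
    fun f => EComb.Uniform f, inferInstance, inferInstance, ?_, EComb.isIILU_uniform, ?_, ?_⟩
  · rw [EComb.card_unaryLang, mk_out]
  · rintro ⟨M, _, hM, h⟩
    exact EComb.not_isELeast_of_elementarilyEquivalent M hM h
  · refine le_trans ?_ EComb.two_power_le_eSp_comb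
    rw [mk_out]
    exact max_le (power_le_power_left two_ne_zero hκ) (cantor κ).le
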